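/- **Setting.** Let $x_{k+1}=f_\theta(x_k,u_k)+w_k$ with $x_k,w_k\in\mathbb R^n$, $u_k\in\mathbb R^m$ and, for $\theta\in\mathbb R^S$, $f_\theta(x,u)=f_0(x,u)+\sum_{j=1}^S\theta_jf_j(x,u)$, where $f_j:\mathbb R^n\times\mathbb R^m\to\mathbb R^n$. Let $\varphi(x,u)\in\mathbb R^{S\times n}$ be defined by $\varphi(x,u)^\top=[f_1(x,u)\ \cdots\ f_S(x,u)]$. Fix $M\ge 1$. A sequence $\{x_k,u_k\}$ is called *persistently exciting (PE) for all $k\ge k_0$* if there are $\alpha,\beta>0$ such that for all $j\ge k_0$, in the order of symmetric matrices, $$\alpha I_S\le\sum_{i=j}^{j+M-1}\varphi(x_i,u_i)\varphi(x_i,u_i)^\top\le\beta I_S .$$ Let $\theta$ be the true parameter and let $\{x_r(k),u_r(k)\}_{k\ge0}$ be a feasible PE reference trajectory of period $M$: $x_r(k+1)=f_\theta(x_r(k),u_r(k))$, $x_r(k+M)=x_r(k)$, $u_r(k+M)=u_r(k)$ for all $k\ge 0$, and $\{x_r(k),u_r(k)\}$ is PE for all $k\ge0$. Let $Q=Q^\top>0$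 and $R=R^\top>0$. For a horizon $N\ge1$, a parameter $\vartheta\in\mathbb R^S$, a state $x$, a time $k$ and $\mathbf u^N=(u_{0|k},\dots,u_{N-1|k})\in(\mathbb R^m)^N$ put $$J_N^{\vartheta}(x,\mathbf u^N,k)=\sum_{i=0}^{N-1}\Big(|x_{i|k}-x_r(k+i)|_Q^2+|u_{i|k}-u_r(k+i)|_R^2\Big),\qquad x_{0|k}=x,\quad x_{i+1|k}=f_\vartheta(x_{i|k},u_{i|k}),$$ where $|v|_P^2=v^\top Pv$. The MPC with horizon $N$ and parameter estimates $\hat\theta_k$ applies at each time $k$ the first element $u_k=u^\star_{0|k}$ of a minimizer of $J_N^{\hat\theta_k}(x_k,\cdot,k)$, which gives the closed loop $x_{k+1}=f_\theta(x_k,u_k)+w_k$. **Assumptions.** 1. $f_0,\dots,f_S$ are twice continuously differentiable. 2. For every $N\ge 1$ and $k\ge 0$, the Hessian of $\mathbf u^N\mapsto J_N^{\theta}(x_r(k),\mathbf u^N,k)$ is positive definite at every minimizer $\mathbf u^{\star N}$ of this function. 3. There are $\kappa:\mathbb R^n\times\mathbb R^n\times\mathbb R^m\to\mathbb R^m$,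 a function $V_\delta:\mathbb R^n\times\mathbb R^n\times\mathbb R^m\to\mathbb R_{\ge0}$ that is continuous in its first argument with $V_\delta(x',x',u')=0$ for all $(x',u')$, and constants $c_{\delta,l},c_{\delta,u},\delta_{loc},k_{max}>0$, $\rho\in(0,1)$, such that for all $(x,x',u')$ with $V_\delta(x,x',u')\le\delta_{loc}$: $c_{\delta,l}|x-x'|^2\le V_\delta(x,x',u')\le c_{\delta,u}|x-x'|^2$, $\ |\kappa(x,x',u')-u'|\le k_{max}|x-x'|$, and, for every $u'^+\in\mathbb R^m$, $V_\delta(x^+,x'^+,u'^+)\le\rho V_\delta(x,x',u')$, where $x^+=f_\theta(x,\kappa(x,x',u'))$ and $x'^+=f_\theta(x',u')$. **Corollary.** Under Assumptions 1–3 there are $c_x>0$ and $N_0\ge 1$ such that for every horizon $N\ge N_0$ there are $\bar w,c_\theta>0$ and $k_{PE}\in\mathbb N_{\ge 0}$ with the following properties. (i) Every closed-loop sequence $\{x_k,u_k\}$ of the MPC with horizon $N$ with $|x_0-x_r(0)|\le c_x$, and with $|w_k|\le\bar w$ and $|\theta-\hat\theta_k|\le c_\theta$ for all $k\ge 0$,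 is PE for all $k\ge k_{PE}$. (ii) If $\{x_k,u_k\}$ is a sequence as in (i), $\bar k\ge k_{PE}$ is a multiple of $M$, and $\{x'_k,u'_k\}$ is a closed-loop sequence of the MPC with horizon $N$ that starts at $x'_0=x_{\bar k}$, with any disturbances $|w'_k|\le\bar w$ and estimates $|\theta-\hat\theta'_k|\le c_\theta$ for all $k\ge 0$, then $\{x'_k,u'_k\}$ is PE for all $k\ge0$. -/

import Mathlib

open scoped Matrix

noncomputable section

namespace AdaptiveMPC

/-- `ℝᵈ` with the Euclidean norm. -/
abbrev Vec (d : ℕ) : Type := EuclideanSpace ℝ (Fin d)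

/-- The basis functions `f₀, f₁, …, f_S : ℝⁿ × ℝᵐ → ℝⁿ` of a model that is affine in its
parameter. -/
structure Model (n m S : ℕ) where
  base : Vec n → Vec m → Vec n
  basis : Fin S → Vec n → Vec m → Vec n

variable {n m S : ℕ}

/-- The nominal dynamics `f(x, u) = f₀(x, u) + ∑ⱼ θⱼ fⱼ(x, u)` for the parameter `θ`. -/
def Model.dyn (sys : Model n m S) (θ : Vec S) (x : Vec n) (u : Vec m) : Vec n :=
  sys.base x u + ∑ j, θ j • sys.basis j x u

/-- The basis functions are twice continuously differentiable, jointly in `(x, u)`. -/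
def Model.IsC2 (sys : Model n m S) : Prop :=
  ContDiff ℝ 2 (fun p : Vec n × Vec m => sys.base p.1 p.2) ∧
    ∀ j, ContDiff ℝ 2 (fun p : Vec n × Vec m => sys.basis j p.1 p.2)

/-- The regressor `φ ∈ ℝ^{S × n}`, whose transpose has the columns `f₁(x, u), …, f_S(x, u)`. -/
def Model.regressor (sys : Model n m S) (x : Vec n) (u : Vec m) : Matrix (Fin S) (Fin n) ℝ :=
  Matrix.of fun j i => sys.basis j x u i

/-- The sequence `{x_k, u_k}` is persistently exciting with window length `M` from time `k₀` on:
`0 < α I ≤ ∑_{i=j}^{j+M-1} φᵢ φᵢᵀ ≤ β I` for all `j ≥ k₀`, in the order of symmetric matrices. -/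
def Model.IsPEFrom (sys : Model n m S) (M k₀ : ℕ) (x : ℕ → Vec n) (u : ℕ → Vec m) : Prop :=
  ∃ α β : ℝ, 0 < α ∧ 0 < β ∧ ∀ j, k₀ ≤ j →
    ((∑ i ∈ Finset.Ico j (j + M),
        sys.regressor (x i) (u i) * (sys.regressor (x i) (u i))ᵀ)
      - α • (1 : Matrix (Fin S) (Fin S) ℝ)).PosSemidef ∧
    (β • (1 : Matrix (Fin S) (Fin S) ℝ)
      - ∑ i ∈ Finset.Ico j (j + M),
          sys.regressor (x i) (u i) * (sys.regressor (x i) (u i))ᵀ).PosSemidef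

/-- A feasible period-`M` sequence of the undisturbed system with parameter `θ`. -/
structure Model.IsFeasiblePeriodic (sys : Model n m S) (θ : Vec S) (M : ℕ)
    (xr : ℕ → Vec n) (ur : ℕ → Vec m) : Prop where
  feasible : ∀ k, xr (k + 1) = sys.dyn θ (xr k) (ur k)
  state_periodic : ∀ k, xr (k + M) = xr k
  input_periodic : ∀ k, ur (k + M) = ur k

/-- The weighted square norm `|v|²_P = vᵀ P v`. -/
def weightedSq {d : ℕ} (P : Matrix (Fin d) (Fin d) ℝ) (v : Vec d) : ℝ :=
  v.ofLp ⬝ᵥ (P *ᵥ v.ofLp)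

/-- The data of the tracking cost: the weights and the reference trajectory. -/
structure Tracking (n m : ℕ) where
  Q : Matrix (Fin n) (Fin n) ℝ
  R : Matrix (Fin m) (Fin m) ℝ
  xr : ℕ → Vec n
  ur : ℕ → Vec m

/-- The running cost `|x - x_r(t)|²_Q + |u - u_r(t)|²_R` at the absolute time `t`. -/
def Tracking.stage (T : Tracking n m) (x : Vec n) (u : Vec m) (t : ℕ) : ℝ :=
  weightedSq T.Q (x - T.xr t) + weightedSq T.R (u - T.ur t)

/-- A control sequence of length `N` as a sequence on `ℕ`; the values from `N` on are never used
by the cost. -/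
def extendControl {N : ℕ} (U : Fin N → Vec m) (i : ℕ) : Vec m :=
  if h : i < N then U ⟨i, h⟩ else 0

/-- The state prediction `x_{i|k}` of the undisturbed model with parameter `θ` from `x_{0|k} = x`
under the controls `u_{0|k}, u_{1|k}, …`. -/
def Model.predict (sys : Model n m S) (θ : Vec S) (x : Vec n) (u : ℕ → Vec m) : ℕ → Vec n
  | 0 => x
  | i + 1 => sys.dyn θ (Model.predict sys θ x u i) (u i)

/-- The cost `J_N(x, U, k) = ∑_{i<N} l(x_{i|k}, u_{i|k}, k)`, the predictions being made with the
parameter `θ`. -/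
def Model.cost (sys : Model n m S) (T : Tracking n m) (θ : Vec S) (N : ℕ) (x : Vec n)
    (U : Fin N → Vec m) (k : ℕ) : ℝ :=
  ∑ i : Fin N, T.stage (sys.predict θ x (extendControl U) i) (U i) (k + i)

/-- `U` is a minimizing control sequence of the MPC problem with model parameter `θ`, at the
state `x` and time `k`. -/
def Model.IsMinimizer (sys : Model n m S) (T : Tracking n m) (θ : Vec S) (N : ℕ) (x : Vec n)
    (k : ℕ) (U : Fin N → Vec m) : Prop :=
  ∀ U' : Fin N → Vec m, sys.cost T θ N x U k ≤ sys.cost T θ N x U' k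

/-- `u` is an MPC input at `(x, k)`: the first control of a minimizing sequence. -/
def Model.IsMPCInput (sys : Model n m S) (T : Tracking n m) (θ : Vec S) (N : ℕ) (x : Vec n)
    (k : ℕ) (u : Vec m) : Prop :=
  ∃ (hN : 0 < N) (U : Fin N → Vec m), sys.IsMinimizer T θ N x k U ∧ u = U ⟨0, hN⟩

/-- The Hessian of `J_N` in the control sequence is positive definite at every minimizing control
sequence of the MPC problem (with the true parameter) on the reference, `x_k = x_r(k)`. -/
def Model.HessianPosDef (sys : Model n m S) (T : Tracking n m) (θ : Vec S) (N : ℕ) : Prop :=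
  ∀ (k : ℕ) (U : Fin N → Vec m), sys.IsMinimizer T θ N (T.xr k) k U →
    ∀ v : Fin N → Vec m, v ≠ 0 →
      0 < iteratedFDeriv ℝ 2 (fun W : Fin N → Vec m => sys.cost T θ N (T.xr k) W k) U ![v, v]

/-- Local incremental stabilizability of `x⁺ = F(x, u)`. The input `u'⁺` at the successor of the
reference point is arbitrary. -/
def LocallyIncrementallyStabilizable (F : Vec n → Vec m → Vec n) : Prop :=
  ∃ (κ : Vec n → Vec n → Vec m → Vec m) (V : Vec n → Vec n → Vec m → ℝ)
    (cl cu δ kmax ρ : ℝ),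
    (∀ x x' u', 0 ≤ V x x' u') ∧
    (∀ x' u', Continuous fun x => V x x' u') ∧
    (∀ x' u', V x' x' u' = 0) ∧
    0 < cl ∧ 0 < cu ∧ 0 < δ ∧ 0 < kmax ∧ 0 < ρ ∧ ρ < 1 ∧
    ∀ x x' u', V x x' u' ≤ δ →
      cl * ‖x - x'‖ ^ 2 ≤ V x x' u' ∧
      V x x' u' ≤ cu * ‖x - x'‖ ^ 2 ∧
      ‖κ x x' u' - u'‖ ≤ kmax * ‖x - x'‖ ∧
      ∀ u'next, V (F x (κ x x' u')) (F x' u') u'next ≤ ρ * V x x' u'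

/-- `(x, u)` is a closed-loop sequence of the system with true parameter `θ` and disturbance `w`,
`x_{k+1} = f(x_k, u_k) + w_k`, under MPC of horizon `N` that uses the estimate `θhat k` in place
of `θ` at time `k`; disturbance and estimation error are bounded by `wbar` and `cθ`. -/
structure Model.IsClosedLoop (sys : Model n m S) (T : Tracking n m) (θ : Vec S) (N : ℕ)
    (wbar cθ : ℝ) (θhat : ℕ → Vec S) (w : ℕ → Vec n) (x : ℕ → Vec n) (u : ℕ → Vec m) :
    Prop where
  disturbance : ∀ k, ‖w k‖ ≤ wbar
  estimate : ∀ k, ‖θ - θhat k‖ ≤ cθ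
  input : ∀ k, sys.IsMPCInput T (θhat k) N (x k) k (u k)
  state : ∀ k, x (k + 1) = sys.dyn θ (x k) (u k) + w k

end AdaptiveMPC

end

/-!
The optimal cost that the controller computes at each time serves as a Lyapunov function for the
tracking error.

In a neighbourhood of the reference the stabilizing feedback gives controls of cost at most
`γ * ‖x - x_r‖ ^ 2` for every horizon (`Model.exists_seqCost_le`). Along an optimal prediction the
stage costs therefore sum to a multiple of the initial squared error, so on a long horizon one of
the predicted states is much closer to the reference than the initial one. Following the optimal
controls up to that state and controls of quadratic cost from there on is a control sequence for
the successor state whose cost is smaller by a fixed fraction of the squared tracking error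
(`Model.exists_shifted_control`). No terminal constraint is needed, and both the required horizon
and the neighbourhood are independent of the parameter error and the disturbance.

For a fixed horizon, sublevel sets of the cost are bounded in state and controls, so by uniform
continuity a small parameter error and a small disturbance change the relevant costs by at most
`ε` (`Model.exists_cost_close`). The optimal costs along the closed loop then contract up to an
error `4 * ε` (`Model.IsClosedLoop.exists_lyapunov`), and since they bound the errors of the state
and of the input, both become and remain as small as desired. A restart at a late time that is a
multiple of the period begins close to the reference with the phase of time `0`, and the same
invariance keeps it close for all times.

Persistent excitation is an open condition: the window sums depend continuously on the sequence,
and by periodicity only finitely many points of the reference matter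
(`Model.exists_isPEFrom_of_close`).
-/

namespace AdaptiveMPC

variable {n m S : ℕ}

/-! ### Bounds for the stage cost -/

lemma continuous_weightedSq {d : ℕ} (P : Matrix (Fin d) (Fin d) ℝ) :
    Continuous (weightedSq P) := by
  unfold weightedSq
  fun_prop

lemma weightedSq_smul {d : ℕ} (P : Matrix (Fin d) (Fin d) ℝ) (c : ℝ) (v : Vec d) :
    weightedSq P (c • v) = c ^ 2 * weightedSq P v := by
  simp only [weightedSq, WithLp.ofLp_smul, Matrix.mulVec_smul, smul_dotProduct, dotProduct_smul,
    smul_eq_mul]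
  ring

lemma weightedSq_eq_norm_sq_mul {d : ℕ} (P : Matrix (Fin d) (Fin d) ℝ) {v : Vec d} (hv : v ≠ 0) :
    weightedSq P v = ‖v‖ ^ 2 * weightedSq P (‖v‖⁻¹ • v) := by
  have h : ‖v‖ ≠ 0 := norm_ne_zero_iff.mpr hv
  rw [weightedSq_smul]
  field_simp

lemma weightedSq_zero {d : ℕ} (P : Matrix (Fin d) (Fin d) ℝ) : weightedSq P 0 = 0 := by
  simp [weightedSq]

/-- By homogeneity it suffices to bound the form below on the unit sphere, which is compact. -/
lemma exists_mul_norm_sq_le_weightedSq {d : ℕ} {P : Matrix (Fin d) (Fin d) ℝ} (hP : P.PosDef) :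
    ∃ a : ℝ, 0 < a ∧ ∀ v, a * ‖v‖ ^ 2 ≤ weightedSq P v := by
  obtain ⟨a, ha, h⟩ := (isCompact_sphere (0 : Vec d) 1).exists_forall_le'
    (continuous_weightedSq P).continuousOn (a := 0) (by
      intro v hv
      have hv0 : v.ofLp ≠ 0 := by
        intro h0
        have : v = 0 := by ext i; simp [h0]
        simp [this] at hv
      simpa [weightedSq] using hP.dotProduct_mulVec_pos hv0)
  refine ⟨a, ha, fun v => ?_⟩
  rcases eq_or_ne v 0 with rfl | hv
  · simp [weightedSq_zero]
  · rw [weightedSq_eq_norm_sq_mul P hv, mul_comm]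
    exact mul_le_mul_of_nonneg_left (h _ (by simp [norm_smul, hv])) (sq_nonneg _)

lemma exists_weightedSq_le_mul_norm_sq {d : ℕ} (P : Matrix (Fin d) (Fin d) ℝ) :
    ∃ b : ℝ, ∀ v, weightedSq P v ≤ b * ‖v‖ ^ 2 := by
  obtain ⟨b, h⟩ := (isCompact_sphere (0 : Vec d) 1).exists_bound_of_continuousOn
    (continuous_weightedSq P).continuousOn
  refine ⟨b, fun v => ?_⟩
  rcases eq_or_ne v 0 with rfl | hv
  · simp [weightedSq_zero]
  · rw [weightedSq_eq_norm_sq_mul P hv, mul_comm]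
    exact mul_le_mul_of_nonneg_right
      ((le_abs_self _).trans (h _ (by simp [norm_smul, hv]))) (sq_nonneg _)

lemma Tracking.exists_stage_bounds (T : Tracking n m) (hQ : T.Q.PosDef) (hR : T.R.PosDef) :
    ∃ a b : ℝ, 0 < a ∧ 0 < b ∧ ∀ x u t,
      a * (‖x - T.xr t‖ ^ 2 + ‖u - T.ur t‖ ^ 2) ≤ T.stage x u t ∧
      T.stage x u t ≤ b * (‖x - T.xr t‖ ^ 2 + ‖u - T.ur t‖ ^ 2) := by
  obtain ⟨a₁, h₁, H₁⟩ := exists_mul_norm_sq_le_weightedSq hQ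
  obtain ⟨a₂, h₂, H₂⟩ := exists_mul_norm_sq_le_weightedSq hR
  obtain ⟨b₁, H₃⟩ := exists_weightedSq_le_mul_norm_sq T.Q
  obtain ⟨b₂, H₄⟩ := exists_weightedSq_le_mul_norm_sq T.R
  refine ⟨min a₁ a₂, max 1 (max b₁ b₂), lt_min h₁ h₂, by positivity, fun x u t => ?_⟩
  have m₁ : b₁ ≤ max 1 (max b₁ b₂) := (le_max_left _ _).trans (le_max_right _ _)
  have m₂ : b₂ ≤ max 1 (max b₁ b₂) := (le_max_right _ _).trans (le_max_right _ _)
  rw [mul_add, mul_add]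
  exact ⟨add_le_add
      ((mul_le_mul_of_nonneg_right (min_le_left _ _) (sq_nonneg _)).trans (H₁ _))
      ((mul_le_mul_of_nonneg_right (min_le_right _ _) (sq_nonneg _)).trans (H₂ _)),
    add_le_add ((H₃ _).trans (mul_le_mul_of_nonneg_right m₁ (sq_nonneg _)))
      ((H₄ _).trans (mul_le_mul_of_nonneg_right m₂ (sq_nonneg _)))⟩

/-! ### Costs of infinite control sequences -/

/-- The cost of the first `N` steps under an infinite control sequence. Shifting and
concatenating controls is easier here than for sequences indexed by `Fin N`. -/
noncomputable def Model.seqCost (sys : Model n m S) (T : Tracking n m) (θ : Vec S) (N : ℕ)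
    (x : Vec n) (u : ℕ → Vec m) (k : ℕ) : ℝ :=
  ∑ i ∈ Finset.range N, T.stage (sys.predict θ x u i) (u i) (k + i)

lemma Model.predict_congr (sys : Model n m S) (θ : Vec S) (x : Vec n) {u v : ℕ → Vec m} {a : ℕ}
    (h : ∀ i < a, u i = v i) : sys.predict θ x u a = sys.predict θ x v a := by
  induction a with
  | zero => rfl
  | succ a ih =>
    simp only [Model.predict]
    rw [ih fun i hi => h i (by omega), h a (by omega)]

lemma Model.predict_add (sys : Model n m S) (θ : Vec S) (x : Vec n) (u : ℕ → Vec m) (a b : ℕ) :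
    sys.predict θ x u (a + b) = sys.predict θ (sys.predict θ x u a) (fun i => u (a + i)) b := by
  induction b with
  | zero => rfl
  | succ b ih =>
    rw [← add_assoc]
    simp only [Model.predict]
    rw [ih]

lemma Model.seqCost_congr (sys : Model n m S) (T : Tracking n m) (θ : Vec S) {N : ℕ} (x : Vec n)
    {u v : ℕ → Vec m} (k : ℕ) (h : ∀ i < N, u i = v i) :
    sys.seqCost T θ N x u k = sys.seqCost T θ N x v k := by
  refine Finset.sum_congr rfl fun i hi => ?_
  have hi := Finset.mem_range.mp hi
  rw [sys.predict_congr θ x fun j hj => h j (hj.trans hi), h i hi]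

lemma Model.seqCost_add (sys : Model n m S) (T : Tracking n m) (θ : Vec S) (a b : ℕ)
    (x : Vec n) (u : ℕ → Vec m) (k : ℕ) :
    sys.seqCost T θ (a + b) x u k = sys.seqCost T θ a x u k +
      sys.seqCost T θ b (sys.predict θ x u a) (fun i => u (a + i)) (k + a) := by
  simp only [Model.seqCost, Finset.sum_range_add, sys.predict_add, add_assoc]

lemma Model.cost_eq_seqCost (sys : Model n m S) (T : Tracking n m) (θ : Vec S) (N : ℕ)
    (x : Vec n) (U : Fin N → Vec m) (k : ℕ) :
    sys.cost T θ N x U k = sys.seqCost T θ N x (extendControl U) k := by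
  rw [Model.seqCost, ← Fin.sum_univ_eq_sum_range
    (fun i => T.stage (sys.predict θ x (extendControl U) i) (extendControl U i) (k + i))]
  exact Finset.sum_congr rfl fun i _ => by simp [extendControl]

lemma Model.cost_restrict (sys : Model n m S) (T : Tracking n m) (θ : Vec S) (N : ℕ)
    (x : Vec n) (u : ℕ → Vec m) (k : ℕ) :
    sys.cost T θ N x (fun i => u i) k = sys.seqCost T θ N x u k := by
  rw [sys.cost_eq_seqCost]
  exact sys.seqCost_congr T θ x k fun i hi => by simp [extendControl, hi]

lemma Model.seqCost_mono (sys : Model n m S) (T : Tracking n m)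
    (hT : ∀ x u t, 0 ≤ T.stage x u t) (θ : Vec S) {N N' : ℕ} (h : N ≤ N') (x : Vec n)
    (u : ℕ → Vec m) (k : ℕ) : sys.seqCost T θ N x u k ≤ sys.seqCost T θ N' x u k :=
  Finset.sum_le_sum_of_subset_of_nonneg (Finset.range_mono h) fun _ _ _ => hT _ _ _

lemma Model.stage_le_cost (sys : Model n m S) (T : Tracking n m)
    (hT : ∀ x u t, 0 ≤ T.stage x u t) (θ : Vec S) {N : ℕ} (x : Vec n) (U : Fin N → Vec m)
    (k : ℕ) (i : Fin N) :
    T.stage (sys.predict θ x (extendControl U) i) (U i) (k + i) ≤ sys.cost T θ N x U k :=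
  Finset.single_le_sum
    (f := fun i : Fin N => T.stage (sys.predict θ x (extendControl U) i) (U i) (k + i))
    (fun _ _ => hT _ _ _) (Finset.mem_univ i)

/-! ### Periodicity and continuity of the cost -/

lemma Model.cost_mod (sys : Model n m S) (T : Tracking n m) (θ θ' : Vec S) {M : ℕ}
    (hRef : sys.IsFeasiblePeriodic θ M T.xr T.ur) (N : ℕ) (x : Vec n) (U : Fin N → Vec m)
    (k : ℕ) : sys.cost T θ' N x U (k % M) = sys.cost T θ' N x U k := by
  have hx : Function.Periodic T.xr M := hRef.state_periodic
  have hu : Function.Periodic T.ur M := hRef.input_periodic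
  refine Finset.sum_congr rfl fun i _ => ?_
  have e : (k % M + i) % M = (k + i) % M := Nat.mod_add_mod k M i
  simp only [Tracking.stage]
  rw [← hx.map_mod_nat (k % M + i), ← hu.map_mod_nat (k % M + i), e, hx.map_mod_nat,
    hu.map_mod_nat]

lemma Model.IsC2.continuous_dyn {sys : Model n m S} (h : sys.IsC2) :
    Continuous fun p : Vec S × Vec n × Vec m => sys.dyn p.1 p.2.1 p.2.2 := by
  have h0 := h.1.continuous
  have hj := fun j => (h.2 j).continuous
  unfold Model.dyn
  refine (h0.comp continuous_snd).add (continuous_finsetSum _ fun j _ => ?_)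
  have hθ : Continuous fun p : Vec S × Vec n × Vec m => p.1 j := by fun_prop
  exact hθ.smul ((hj j).comp continuous_snd)

lemma Model.IsC2.continuous_predict {sys : Model n m S} (h : sys.IsC2) (N i : ℕ) :
    Continuous fun p : Vec S × Vec n × (Fin N → Vec m) =>
      sys.predict p.1 p.2.1 (extendControl p.2.2) i := by
  induction i with
  | zero => exact continuous_fst.comp continuous_snd
  | succ i ih =>
    have hu : Continuous fun p : Vec S × Vec n × (Fin N → Vec m) => extendControl p.2.2 i := by
      by_cases hi : i < N
      · simp only [extendControl, hi, dif_pos]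
        fun_prop
      · simp only [extendControl, hi, dif_neg, not_false_eq_true]
        fun_prop
    exact h.continuous_dyn.comp (continuous_fst.prodMk (ih.prodMk hu))

lemma Model.IsC2.continuous_cost {sys : Model n m S} (h : sys.IsC2) (T : Tracking n m)
    (N k : ℕ) : Continuous fun p : Vec S × Vec n × (Fin N → Vec m) =>
      sys.cost T p.1 N p.2.1 p.2.2 k := by
  refine continuous_finsetSum _ fun i _ => Continuous.add ?_ ?_
  · exact (continuous_weightedSq _).comp ((h.continuous_predict N i).sub continuous_const)
  · exact (continuous_weightedSq _).comp (by fun_prop)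

/-- On bounded sets of states and controls the cost depends uniformly continuously on the
parameter and on the initial state, with a modulus that does not depend on the time. -/
lemma Model.exists_cost_close_of_bounded (sys : Model n m S) (T : Tracking n m) (θ : Vec S)
    {M : ℕ} (hM : 0 < M) (hC2 : sys.IsC2) (hRef : sys.IsFeasiblePeriodic θ M T.xr T.ur)
    (N : ℕ) (r : ℝ) {ε : ℝ} (hε : 0 < ε) :
    ∃ d : ℝ, 0 < d ∧ d ≤ 1 ∧ ∀ k x x' θ' (U : Fin N → Vec m), ‖x - T.xr k‖ ≤ r →
      (∀ i : Fin N, ‖U i - T.ur (k + i)‖ ≤ r) → ‖θ - θ'‖ ≤ d → ‖x - x'‖ ≤ d →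
      |sys.cost T θ' N x' U k - sys.cost T θ N x U k| ≤ ε := by
  have hx : Function.Periodic T.xr M := hRef.state_periodic
  have hu : Function.Periodic T.ur M := hRef.input_periodic
  have key : ∀ k : ℕ, ∃ d : ℝ, 0 < d ∧ ∀ x x' θ' (U : Fin N → Vec m), ‖x - T.xr k‖ ≤ r →
      (∀ i : Fin N, ‖U i - T.ur (k + i)‖ ≤ r) → ‖θ - θ'‖ ≤ min d 1 → ‖x - x'‖ ≤ min d 1 →
      |sys.cost T θ' N x' U k - sys.cost T θ N x U k| ≤ ε := by
    intro k
    have hK : IsCompact (Metric.closedBall θ 1 ×ˢ Metric.closedBall (T.xr k) (r + 1) ×ˢ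
        Metric.closedBall (fun i : Fin N => T.ur (k + i)) |r|) :=
      (isCompact_closedBall _ _).prod ((isCompact_closedBall _ _).prod (isCompact_closedBall _ _))
    obtain ⟨d, hd, H⟩ := Metric.uniformContinuousOn_iff.mp
      (hK.uniformContinuousOn_of_continuous (hC2.continuous_cost T N k).continuousOn) ε hε
    refine ⟨d / 2, by positivity, fun x x' θ' U h1 h2 h3 h4 => ?_⟩
    have h2' : U ∈ Metric.closedBall (fun i : Fin N => T.ur (k + i)) |r| := by
      rw [Metric.mem_closedBall, dist_pi_le_iff (abs_nonneg r)]
      exact fun i => by rw [dist_eq_norm]; exact (h2 i).trans (le_abs_self r)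
    have h5 : ‖x' - T.xr k‖ ≤ r + 1 := by
      have := norm_sub_le_norm_sub_add_norm_sub x' x (T.xr k)
      rw [norm_sub_rev x' x] at this
      linarith [h4.trans (min_le_right _ _)]
    have := H (θ', x', U) ⟨by simpa [dist_eq_norm, norm_sub_rev] using h3.trans (min_le_right _ _),
        by simpa [dist_eq_norm] using h5, h2'⟩ (θ, x, U)
      ⟨by simp, by simpa [dist_eq_norm] using by linarith, h2'⟩ (by
        rw [Prod.dist_eq, Prod.dist_eq]
        simp only [dist_self, dist_eq_norm, norm_sub_rev θ', norm_sub_rev x']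
        have := h3.trans (min_le_left _ _)
        have := h4.trans (min_le_left _ _)
        simp only [max_lt_iff]
        exact ⟨by linarith, by linarith, hd⟩)
    exact this.le
  choose d hd H using key
  have hne : (Finset.range M).Nonempty := Finset.nonempty_range_iff.mpr hM.ne'
  refine ⟨min ((Finset.range M).inf' hne d) 1,
    lt_min ((Finset.lt_inf'_iff _).mpr fun k _ => hd k) one_pos, min_le_right _ _,
    fun k x x' θ' U h1 h2 h3 h4 => ?_⟩
  have hle : min ((Finset.range M).inf' hne d) 1 ≤ min (d (k % M)) 1 :=
    min_le_min_right _ (Finset.inf'_le _ (Finset.mem_range.mpr (Nat.mod_lt k hM)))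
  rw [← sys.cost_mod T θ θ' hRef, ← sys.cost_mod T θ θ hRef]
  refine H (k % M) x x' θ' U (by rwa [hx.map_mod_nat]) (fun i => ?_) (h3.trans hle) (h4.trans hle)
  rw [← hu.map_mod_nat, Nat.mod_add_mod, hu.map_mod_nat]
  exact h2 i

/-- A bound on one of the two costs confines both states and the controls to a bounded set, so
nearby parameters and initial states give nearby costs. -/
lemma Model.exists_cost_close (sys : Model n m S) (T : Tracking n m) (θ : Vec S)
    {M : ℕ} (hM : 0 < M) (hC2 : sys.IsC2) (hRef : sys.IsFeasiblePeriodic θ M T.xr T.ur)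
    {a : ℝ} (ha : 0 < a)
    (hlow : ∀ x u t, a * (‖x - T.xr t‖ ^ 2 + ‖u - T.ur t‖ ^ 2) ≤ T.stage x u t)
    {N : ℕ} (hN : 0 < N) (B : ℝ) {ε : ℝ} (hε : 0 < ε) :
    ∃ d : ℝ, 0 < d ∧ ∀ k x x' θ' (U : Fin N → Vec m), ‖θ - θ'‖ ≤ d → ‖x - x'‖ ≤ d →
      (sys.cost T θ N x U k ≤ B ∨ sys.cost T θ' N x' U k ≤ B) →
      |sys.cost T θ' N x' U k - sys.cost T θ N x U k| ≤ ε := by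
  have hT : ∀ x u t, 0 ≤ T.stage x u t := fun x u t => le_trans (by positivity) (hlow x u t)
  obtain ⟨d, hd, hd1, H⟩ :=
    sys.exists_cost_close_of_bounded T θ hM hC2 hRef N (√(B / a) + 1) hε
  refine ⟨d, hd, fun k x x' θ' U h1 h2 h3 => ?_⟩
  have bound : ∀ (η : Vec S) (y : Vec n), sys.cost T η N y U k ≤ B →
      ‖y - T.xr k‖ ≤ √(B / a) ∧ ∀ i : Fin N, ‖U i - T.ur (k + i)‖ ≤ √(B / a) := by
    intro η y hB
    have hs : ∀ i : Fin N, ‖sys.predict η y (extendControl U) i - T.xr (k + i)‖ ^ 2 +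
        ‖U i - T.ur (k + i)‖ ^ 2 ≤ B / a := fun i => by
      rw [le_div_iff₀' ha]
      exact ((hlow _ _ _).trans (sys.stage_le_cost T hT η y U k i)).trans hB
    refine ⟨Real.le_sqrt_of_sq_le ?_, fun i => Real.le_sqrt_of_sq_le ?_⟩
    · have := hs ⟨0, hN⟩
      simp only [Model.predict, add_zero] at this
      linarith [sq_nonneg ‖U ⟨0, hN⟩ - T.ur k‖]
    · linarith [hs i, sq_nonneg ‖sys.predict η y (extendControl U) i - T.xr (k + i)‖]
  rcases h3 with h3 | h3
  · obtain ⟨b1, b2⟩ := bound _ _ h3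
    exact H k x x' θ' U (by linarith) (fun i => by linarith [b2 i]) h1 h2
  · obtain ⟨b1, b2⟩ := bound _ _ h3
    have := norm_sub_le_norm_sub_add_norm_sub x x' (T.xr k)
    exact H k x x' θ' U (by linarith) (fun i => by linarith [b2 i]) h1 h2

/-! ### The stabilizing feedback -/

/-- The state reached after `i` steps by `F` under the feedback `κ` around the reference
trajectory, started at `x` at time `k`. -/
noncomputable def feedbackState (F : Vec n → Vec m → Vec n) (κ : Vec n → Vec n → Vec m → Vec m)
    (T : Tracking n m) (x : Vec n) (k : ℕ) : ℕ → Vec n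
  | 0 => x
  | i + 1 => F (feedbackState F κ T x k i)
      (κ (feedbackState F κ T x k i) (T.xr (k + i)) (T.ur (k + i)))

/-- Near the reference, the optimal cost is at most quadratic in the tracking error, uniformly
in the horizon: the local feedback makes the stage costs decay geometrically. -/
lemma Model.exists_seqCost_le (sys : Model n m S) (T : Tracking n m) (θ : Vec S)
    {M : ℕ} (hM : 0 < M) (hRef : sys.IsFeasiblePeriodic θ M T.xr T.ur)
    (hStab : LocallyIncrementallyStabilizable (sys.dyn θ)) {b : ℝ} (hb : 0 < b)
    (hup : ∀ x u t, T.stage x u t ≤ b * (‖x - T.xr t‖ ^ 2 + ‖u - T.ur t‖ ^ 2)) :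
    ∃ C γ : ℝ, 0 < C ∧ ∀ N k x, ‖x - T.xr k‖ ^ 2 ≤ C →
      ∃ u : ℕ → Vec m, sys.seqCost T θ N x u k ≤ γ * ‖x - T.xr k‖ ^ 2 := by
  obtain ⟨κ, V, cl, cu, δ, kmax, ρ, -, hVc, hV0, hcl, hcu, hδ, hk, hρ, hρ1, H⟩ := hStab
  have hx : Function.Periodic T.xr M := hRef.state_periodic
  have hu : Function.Periodic T.ur M := hRef.input_periodic
  have key : ∀ k, ∃ c : ℝ, 0 < c ∧ ∀ x, ‖x - T.xr k‖ < c → V x (T.xr k) (T.ur k) ≤ δ := by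
    intro k
    obtain ⟨c, hc, h⟩ := Metric.continuous_iff.mp (hVc (T.xr k) (T.ur k)) (T.xr k) δ hδ
    refine ⟨c, hc, fun x hxc => ?_⟩
    have := h x (by rwa [dist_eq_norm])
    rw [hV0, dist_zero_right] at this
    exact (le_abs_self _).trans this.le
  choose c hc hcV using key
  have hne : (Finset.range M).Nonempty := Finset.nonempty_range_iff.mpr hM.ne'
  set c₀ := (Finset.range M).inf' hne c with hc₀
  have hc₀pos : 0 < c₀ := (Finset.lt_inf'_iff _).mpr fun k _ => hc k
  have hloc : ∀ k x, ‖x - T.xr k‖ < c₀ → V x (T.xr k) (T.ur k) ≤ δ := by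
    intro k x h
    rw [← hx.map_mod_nat, ← hu.map_mod_nat]
    refine hcV (k % M) x ?_
    rw [hx.map_mod_nat]
    exact h.trans_le (Finset.inf'_le _ (Finset.mem_range.mpr (Nat.mod_lt k hM)))
  refine ⟨(c₀ / 2) ^ 2, b * (1 + kmax ^ 2) * (cu / cl) * (1 - ρ)⁻¹, by positivity,
    fun N k x hxC => ?_⟩
  have hx0 : V x (T.xr k) (T.ur k) ≤ δ :=
    hloc k x (by linarith [abs_le_of_sq_le_sq' hxC (by positivity) |>.2])
  set y := feedbackState (sys.dyn θ) κ T x k with hy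
  set u : ℕ → Vec m := fun i => κ (y i) (T.xr (k + i)) (T.ur (k + i)) with hu'
  have hpred : ∀ i, sys.predict θ x u i = y i := by
    intro i
    induction i with
    | zero => rfl
    | succ i ih => simp only [Model.predict, ih]; rfl
  have hVi : ∀ i, V (y i) (T.xr (k + i)) (T.ur (k + i)) ≤ ρ ^ i * V x (T.xr k) (T.ur k) ∧
      V (y i) (T.xr (k + i)) (T.ur (k + i)) ≤ δ := by
    intro i
    induction i with
    | zero => simpa [hy, feedbackState] using hx0
    | succ i ih =>
      have h1 := (H _ _ _ ih.2).2.2.2 (T.ur (k + (i + 1)))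
      rw [← hRef.feasible] at h1
      have h2 : V (y (i + 1)) (T.xr (k + (i + 1))) (T.ur (k + (i + 1))) ≤
          ρ * V (y i) (T.xr (k + i)) (T.ur (k + i)) := h1
      have h3 := le_trans (by positivity) (H _ _ _ ih.2).1
      refine ⟨h2.trans ?_, h2.trans ?_⟩
      · rw [pow_succ', mul_assoc]
        exact mul_le_mul_of_nonneg_left ih.1 hρ.le
      · nlinarith [ih.2]
  have hstage : ∀ i, T.stage (y i) (u i) (k + i) ≤
      b * (1 + kmax ^ 2) * (cu / cl) * ‖x - T.xr k‖ ^ 2 * ρ ^ i := by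
    intro i
    obtain ⟨h1, -, h2, -⟩ := H _ _ _ (hVi i).2
    have h3 : ‖u i - T.ur (k + i)‖ ^ 2 ≤ kmax ^ 2 * ‖y i - T.xr (k + i)‖ ^ 2 := by
      rw [← mul_pow]
      exact pow_le_pow_left₀ (norm_nonneg _) h2 2
    have h4 : ‖y i - T.xr (k + i)‖ ^ 2 ≤ (cu / cl) * ‖x - T.xr k‖ ^ 2 * ρ ^ i := by
      have h5 := (H _ _ _ hx0).2.1
      have h6 : cl * ‖y i - T.xr (k + i)‖ ^ 2 ≤ ρ ^ i * (cu * ‖x - T.xr k‖ ^ 2) :=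
        (h1.trans (hVi i).1).trans (mul_le_mul_of_nonneg_left h5 (by positivity))
      calc ‖y i - T.xr (k + i)‖ ^ 2 ≤ ρ ^ i * (cu * ‖x - T.xr k‖ ^ 2) / cl :=
            (le_div_iff₀' hcl).mpr h6
        _ = _ := by ring
    calc T.stage (y i) (u i) (k + i)
        ≤ b * (‖y i - T.xr (k + i)‖ ^ 2 + ‖u i - T.ur (k + i)‖ ^ 2) := hup _ _ _
      _ ≤ b * ((1 + kmax ^ 2) * ‖y i - T.xr (k + i)‖ ^ 2) := by
          refine mul_le_mul_of_nonneg_left ?_ hb.le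
          linarith
      _ ≤ b * ((1 + kmax ^ 2) * ((cu / cl) * ‖x - T.xr k‖ ^ 2 * ρ ^ i)) := by gcongr
      _ = _ := by ring
  refine ⟨u, ?_⟩
  calc sys.seqCost T θ N x u k
      = ∑ i ∈ Finset.range N, T.stage (y i) (u i) (k + i) :=
        Finset.sum_congr rfl fun i _ => by rw [hpred]
    _ ≤ ∑ i ∈ Finset.range N, b * (1 + kmax ^ 2) * (cu / cl) * ‖x - T.xr k‖ ^ 2 * ρ ^ i :=
        Finset.sum_le_sum fun i _ => hstage i
    _ = b * (1 + kmax ^ 2) * (cu / cl) * ‖x - T.xr k‖ ^ 2 * ∑ i ∈ Finset.range N, ρ ^ i := by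
        rw [Finset.mul_sum]
    _ ≤ b * (1 + kmax ^ 2) * (cu / cl) * ‖x - T.xr k‖ ^ 2 * (1 - ρ)⁻¹ := by
        gcongr
        rw [← tsum_geometric_of_lt_one hρ.le hρ1]
        exact (summable_geometric_of_lt_one hρ.le hρ1).sum_le_tsum _ fun i _ => by positivity
    _ = _ := by ring

/-! ### Decrease of the optimal cost along the closed loop -/

/-- Some predicted state after the first is close to the reference, since the tracking errors
sum to at most a fixed multiple of the first one. From there on the optimal tail is replaced by a
control sequence of quadratic cost, which is how a feasible control for the successor state
arises. -/
lemma Model.exists_shifted_control (sys : Model n m S) (T : Tracking n m) (θ : Vec S)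
    {a C γ : ℝ} (ha : 0 < a) (hC : 0 < C) (haγ : a ≤ γ)
    (hlow : ∀ x u t, a * (‖x - T.xr t‖ ^ 2 + ‖u - T.ur t‖ ^ 2) ≤ T.stage x u t)
    (hγ : ∀ N k x, ‖x - T.xr k‖ ^ 2 ≤ C →
      ∃ u : ℕ → Vec m, sys.seqCost T θ N x u k ≤ γ * ‖x - T.xr k‖ ^ 2)
    {L : ℕ} (hL : 2 * γ ^ 2 ≤ a ^ 2 * L) {x : Vec n} {k : ℕ} {u : ℕ → Vec m} {ε : ℝ}
    (hε : 0 ≤ ε) (hεC : ε ≤ a * C / 2) (hxC : ‖x - T.xr k‖ ^ 2 ≤ C)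
    (hcost : sys.seqCost T θ (L + 1) x u k ≤ γ * ‖x - T.xr k‖ ^ 2 + 2 * ε) :
    ∃ v : ℕ → Vec m, sys.seqCost T θ (L + 1) (sys.dyn θ x (u 0)) v (k + 1) ≤
      sys.seqCost T θ (L + 1) x u k - a / 2 * ‖x - T.xr k‖ ^ 2 + ε := by
  have hT : ∀ x u t, 0 ≤ T.stage x u t := fun x u t => le_trans (by positivity) (hlow x u t)
  have hγ0 : 0 < γ := ha.trans_le haγ
  set x₁ := sys.dyn θ x (u 0) with hx₁
  set u₁ : ℕ → Vec m := fun i => u (1 + i) with hu₁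
  set e : ℕ → ℝ := fun j => ‖sys.predict θ x₁ u₁ j - T.xr (k + 1 + j)‖ ^ 2 with he
  set e₀ := ‖x - T.xr k‖ ^ 2 with he₀
  have hsplit : ∀ N, sys.seqCost T θ (1 + N) x u k =
      T.stage x (u 0) k + sys.seqCost T θ N x₁ u₁ (k + 1) := by
    intro N
    rw [sys.seqCost_add]
    simp [Model.seqCost, Model.predict, hx₁, hu₁]
  have hl₀ : a * e₀ ≤ T.stage x (u 0) k := by
    refine le_trans ?_ (hlow _ _ _)
    exact mul_le_mul_of_nonneg_left (by linarith [sq_nonneg ‖u 0 - T.ur k‖]) ha.le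
  have h2γ : 2 * γ ≤ a * L := by
    have h1 : γ * (2 * γ) ≤ γ * (a * L) := by
      have : a * (a * L) ≤ γ * (a * L) := mul_le_mul_of_nonneg_right haγ (by positivity)
      nlinarith
    exact le_of_mul_le_mul_left h1 hγ0
  have hLpos : (0 : ℝ) < L := by
    by_contra h
    nlinarith
  have hLne : (Finset.range L).Nonempty :=
    Finset.nonempty_range_iff.mpr (by rintro rfl; simp at hLpos)
  have hsum : a * ∑ j ∈ Finset.range L, e j ≤ γ * e₀ + 2 * ε := by
    have h1 : a * ∑ j ∈ Finset.range L, e j ≤ sys.seqCost T θ L x₁ u₁ (k + 1) := by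
      rw [Finset.mul_sum]
      refine Finset.sum_le_sum fun j _ => le_trans ?_ (hlow _ _ _)
      exact mul_le_mul_of_nonneg_left (by linarith [sq_nonneg ‖u₁ j - T.ur (k + 1 + j)‖]) ha.le
    have h2 := hsplit L
    rw [add_comm 1 L] at h2
    linarith [hT x (u 0) k]
  obtain ⟨j, hj, hje⟩ : ∃ j ∈ Finset.range L, e j ≤ (γ * e₀ + 2 * ε) / (a * L) := by
    refine Finset.exists_le_of_sum_le hLne ?_
    rw [Finset.sum_const, Finset.card_range, nsmul_eq_mul]
    calc ∑ j ∈ Finset.range L, e j ≤ (γ * e₀ + 2 * ε) / a := (le_div_iff₀' ha).mpr hsum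
      _ = _ := by field_simp
  -- Half of the first stage cost pays for the new tail; this is where a long horizon is needed.
  have hγe : γ * e j ≤ a / 2 * e₀ + ε := by
    have h1 : γ * e j * (a * L) ≤ γ * (γ * e₀ + 2 * ε) := by
      rw [mul_assoc]
      exact mul_le_mul_of_nonneg_left ((le_div_iff₀ (by positivity)).mp hje) hγ0.le
    have h2 : γ * (γ * e₀ + 2 * ε) ≤ (a / 2 * e₀ + ε) * (a * L) := by
      have h3 : 2 * γ ^ 2 * e₀ ≤ a ^ 2 * L * e₀ := mul_le_mul_of_nonneg_right hL (sq_nonneg _)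
      have h4 : 2 * γ * ε ≤ a * L * ε := mul_le_mul_of_nonneg_right h2γ hε
      linarith
    exact le_of_mul_le_mul_right (h1.trans h2) (by positivity)
  have hejC : e j ≤ C := by
    have h1 : γ * e j ≤ γ * C := by nlinarith
    exact le_of_mul_le_mul_left h1 hγ0
  obtain ⟨v, hv⟩ := hγ (L + 1 - j) (k + 1 + j) _ hejC
  have hjL := Finset.mem_range.mp hj
  -- The tail `v` starts at time `k + 1 + j` from the state that `u₁` reaches there.
  refine ⟨fun i => if i < j then u₁ i else v (i - j), ?_⟩
  have hN : L + 1 = j + (L + 1 - j) := by omega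
  have hhead : sys.seqCost T θ j x₁ u₁ (k + 1) ≤
      sys.seqCost T θ (L + 1) x u k - T.stage x (u 0) k := by
    have h1 := hsplit L
    rw [add_comm 1 L] at h1
    linarith [sys.seqCost_mono T hT θ hjL.le x₁ u₁ (k + 1)]
  have hpred : sys.predict θ x₁ (fun i => if i < j then u₁ i else v (i - j)) j =
      sys.predict θ x₁ u₁ j := sys.predict_congr θ x₁ fun i hi => by simp [hi]
  have hval : sys.seqCost T θ (j + (L + 1 - j)) x₁ (fun i => if i < j then u₁ i else v (i - j))
      (k + 1) = sys.seqCost T θ j x₁ u₁ (k + 1) +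
        sys.seqCost T θ (L + 1 - j) (sys.predict θ x₁ u₁ j) v (k + 1 + j) := by
    rw [sys.seqCost_add, hpred]
    congr 1
    · exact sys.seqCost_congr T θ x₁ _ fun i hi => by simp [hi]
    · exact sys.seqCost_congr T θ _ _ fun i _ => by simp
  rw [← hN] at hval
  rw [hval]
  linarith

/-- The optimal costs along a closed loop bound the tracking error, are bounded by it near the
reference, and contract up to an error `4 * ε` while they stay below `a * C`. Here `ε` bounds the
change of the cost caused by the parameter error and the disturbance. -/
lemma Model.IsClosedLoop.exists_lyapunov {sys : Model n m S} {T : Tracking n m} {θ : Vec S}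
    {a C γ : ℝ} (ha : 0 < a) (hC : 0 < C) (haγ : a ≤ γ)
    (hlow : ∀ x u t, a * (‖x - T.xr t‖ ^ 2 + ‖u - T.ur t‖ ^ 2) ≤ T.stage x u t)
    (hγ : ∀ N k x, ‖x - T.xr k‖ ^ 2 ≤ C →
      ∃ u : ℕ → Vec m, sys.seqCost T θ N x u k ≤ γ * ‖x - T.xr k‖ ^ 2)
    {L : ℕ} (hL : 2 * γ ^ 2 ≤ a ^ 2 * L) {ε : ℝ} (hε : 0 ≤ ε) (hεC : ε ≤ a * C / 2) {d : ℝ}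
    (hd : 0 ≤ d)
    (hclose : ∀ k x x' θ' (U : Fin (L + 1) → Vec m), ‖θ - θ'‖ ≤ d → ‖x - x'‖ ≤ d →
      (sys.cost T θ (L + 1) x U k ≤ γ * C + 2 * (a * C) ∨
        sys.cost T θ' (L + 1) x' U k ≤ γ * C + 2 * (a * C)) →
      |sys.cost T θ' (L + 1) x' U k - sys.cost T θ (L + 1) x U k| ≤ ε)
    {θhat : ℕ → Vec S} {w x : ℕ → Vec n} {u : ℕ → Vec m}
    (h : sys.IsClosedLoop T θ (L + 1) d d θhat w x u) :
    ∃ P : ℕ → ℝ, (∀ k, a * (‖x k - T.xr k‖ ^ 2 + ‖u k - T.ur k‖ ^ 2) ≤ P k) ∧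
      (∀ k, ‖x k - T.xr k‖ ^ 2 ≤ C → P k ≤ γ * ‖x k - T.xr k‖ ^ 2 + ε) ∧
      ∀ k, P k ≤ a * C → P (k + 1) ≤ (1 - a / (2 * γ)) * P k + 4 * ε := by
  have hT : ∀ x u t, 0 ≤ T.stage x u t := fun x u t => le_trans (by positivity) (hlow x u t)
  have hγ0 : 0 < γ := ha.trans_le haγ
  have haC : 0 < a * C := by positivity
  have hγC : 0 < γ * C := by positivity
  choose hN U hU huU using h.input
  have hP1 : ∀ k, a * (‖x k - T.xr k‖ ^ 2 + ‖u k - T.ur k‖ ^ 2) ≤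
      sys.cost T (θhat k) (L + 1) (x k) (U k) k := fun k => by
    refine (hlow _ _ _).trans ?_
    rw [huU k]
    exact sys.stage_le_cost T hT (θhat k) (x k) (U k) k ⟨0, hN k⟩
  have hP2 : ∀ k, ‖x k - T.xr k‖ ^ 2 ≤ C →
      sys.cost T (θhat k) (L + 1) (x k) (U k) k ≤ γ * ‖x k - T.xr k‖ ^ 2 + ε := by
    intro k hk
    obtain ⟨v, hv⟩ := hγ (L + 1) k (x k) hk
    rw [← sys.cost_restrict] at hv
    have h1 := hclose k (x k) (x k) (θhat k) _ (h.estimate k) (by simpa using hd)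
      (Or.inl (hv.trans (by nlinarith)))
    linarith [abs_le.mp h1, hU k (fun i => v i)]
  refine ⟨fun k => sys.cost T (θhat k) (L + 1) (x k) (U k) k, hP1, hP2, fun k hk => ?_⟩
  set P := sys.cost T (θhat k) (L + 1) (x k) (U k) k with hP
  set e₀ := ‖x k - T.xr k‖ ^ 2 with he₀
  have he₀C : e₀ ≤ C := by
    have h1 : a * e₀ ≤ a * C := by nlinarith [hP1 k, sq_nonneg ‖u k - T.ur k‖]
    exact le_of_mul_le_mul_left h1 ha
  have he₀0 : 0 ≤ e₀ := sq_nonneg _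
  -- The minimizer for the estimate, evaluated in the true model.
  have hnom := abs_le.mp (hclose k (x k) (x k) (θhat k) (U k) (h.estimate k) (by simpa using hd)
    (Or.inr (by linarith)))
  rw [← hP, sys.cost_eq_seqCost] at hnom
  obtain ⟨v, hv⟩ := sys.exists_shifted_control T θ ha hC haγ hlow hγ hL hε hεC he₀C
    (u := extendControl (U k)) (by linarith [hP2 k he₀C])
  have hu0 : extendControl (U k) 0 = u k := by
    rw [huU k]
    simp [extendControl]
  rw [hu0, ← sys.cost_restrict] at hv
  -- The candidate for the successor, evaluated in the estimated model at the disturbed state.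
  have hnext := abs_le.mp (hclose (k + 1) _ (x (k + 1)) (θhat (k + 1)) _ (h.estimate _)
    (by simpa [h.state k] using h.disturbance k) (Or.inl (hv.trans (by nlinarith))))
  have hopt := hU (k + 1) (fun i => v i)
  have hstep : sys.cost T (θhat (k + 1)) (L + 1) (x (k + 1)) (U (k + 1)) (k + 1) ≤
      P + 3 * ε - a / 2 * e₀ := by linarith
  have hμ : a / (2 * γ) * (P - ε) ≤ a / 2 * e₀ := by
    calc a / (2 * γ) * (P - ε) ≤ a / (2 * γ) * (γ * e₀) :=
          mul_le_mul_of_nonneg_left (by linarith [hP2 k he₀C]) (by positivity)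
      _ = a / 2 * e₀ := by field_simp
  have hμ1 : a / (2 * γ) * ε ≤ ε := by
    refine mul_le_of_le_one_left hε ?_
    rw [div_le_one (by positivity)]
    linarith
  show sys.cost T (θhat (k + 1)) (L + 1) (x (k + 1)) (U (k + 1)) (k + 1) ≤ _
  linarith

/-! ### Contractions with an additive error -/

/-- The level `Y` is invariant because the error `η` is at most what the contraction gains
there. -/
lemma le_of_perturbed_contraction {P : ℕ → ℝ} {μ Y η : ℝ} (hμ1 : μ ≤ 1) (hη : η ≤ μ * Y)
    (h0 : P 0 ≤ Y) (hP : ∀ k, P k ≤ Y → P (k + 1) ≤ (1 - μ) * P k + η) (k : ℕ) : P k ≤ Y := by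
  induction k with
  | zero => exact h0
  | succ k ih =>
    have := mul_le_mul_of_nonneg_left ih (sub_nonneg.mpr hμ1)
    linarith [hP k ih]

/-- Below the invariant level `Y`, the sequence decays geometrically down to any level `ζ` at which
the contraction still outweighs the error. -/
lemma le_pow_add_of_perturbed_contraction {P : ℕ → ℝ} {μ Y η : ℝ} (hμ1 : μ ≤ 1) (hη : η ≤ μ * Y)
    (h0 : P 0 ≤ Y) (hP : ∀ k, P k ≤ Y → P (k + 1) ≤ (1 - μ) * P k + η) {ζ : ℝ} (hζ0 : 0 ≤ ζ)
    (hζ : η ≤ μ * ζ) (k : ℕ) : P k ≤ (1 - μ) ^ k * Y + ζ := by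
  induction k with
  | zero => simpa using by linarith
  | succ k ih =>
    have h1 := hP k (le_of_perturbed_contraction hμ1 hη h0 hP k)
    have h2 := mul_le_mul_of_nonneg_left ih (sub_nonneg.mpr hμ1)
    rw [pow_succ']
    linarith

/-! ### Persistent excitation near the reference -/

lemma abs_dotProduct_mulVec_le (A : Matrix (Fin S) (Fin S) ℝ) {η : ℝ} (hη : 0 ≤ η)
    (hA : ∀ i j, |A i j| ≤ η) (v : Fin S → ℝ) : |v ⬝ᵥ (A *ᵥ v)| ≤ η * S * (v ⬝ᵥ v) := by
  have h1 : |v ⬝ᵥ (A *ᵥ v)| ≤ ∑ i, ∑ j, |v i| * (η * |v j|) := by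
    simp only [dotProduct, Matrix.mulVec, Finset.mul_sum]
    refine (Finset.abs_sum_le_sum_abs _ _).trans (Finset.sum_le_sum fun i _ =>
      (Finset.abs_sum_le_sum_abs _ _).trans (Finset.sum_le_sum fun j _ => ?_))
    rw [abs_mul, abs_mul]
    gcongr
    exact hA i j
  have h2 : ∑ i, ∑ j, |v i| * (η * |v j|) = η * (∑ i, |v i|) ^ 2 := by
    rw [sq, Finset.sum_mul_sum, Finset.mul_sum]
    refine Finset.sum_congr rfl fun i _ => ?_
    rw [Finset.mul_sum]
    exact Finset.sum_congr rfl fun j _ => by ring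
  have h3 : (∑ i, |v i|) ^ 2 ≤ S * (v ⬝ᵥ v) := by
    have := sq_sum_le_card_mul_sum_sq (s := (Finset.univ : Finset (Fin S))) (f := fun i => |v i|)
    simpa [dotProduct, sq] using this
  calc _ ≤ η * (∑ i, |v i|) ^ 2 := h1.trans h2.le
    _ ≤ η * (S * (v ⬝ᵥ v)) := mul_le_mul_of_nonneg_left h3 hη
    _ = _ := by ring

/-- Symmetric matrices close entrywise to a matrix between `α` and `β` lie between slightly
weaker bounds. -/
lemma posSemidef_bounds_of_close {G H : Matrix (Fin S) (Fin S) ℝ} (hG : G.IsHermitian)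
    {α β η : ℝ} (hη : 0 ≤ η)
    (h1 : (H - α • (1 : Matrix (Fin S) (Fin S) ℝ)).PosSemidef)
    (h2 : (β • (1 : Matrix (Fin S) (Fin S) ℝ) - H).PosSemidef)
    (hGH : ∀ i j, |(G - H) i j| ≤ η) :
    (G - (α - η * S) • (1 : Matrix (Fin S) (Fin S) ℝ)).PosSemidef ∧
      ((β + η * S) • (1 : Matrix (Fin S) (Fin S) ℝ) - G).PosSemidef := by
  have hone : ∀ c : ℝ, (c • (1 : Matrix (Fin S) (Fin S) ℝ)).IsHermitian := fun c => by
    simp [Matrix.IsHermitian]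
  constructor
  · refine Matrix.PosSemidef.of_dotProduct_mulVec_nonneg (hG.sub (hone _)) fun v => ?_
    have e1 := h1.dotProduct_mulVec_nonneg v
    have e3 := abs_le.mp (abs_dotProduct_mulVec_le (G - H) hη hGH v)
    simp only [star_trivial, Matrix.sub_mulVec, Matrix.smul_mulVec, Matrix.one_mulVec,
      dotProduct_sub, dotProduct_smul, smul_eq_mul] at e1 e3 ⊢
    linarith
  · refine Matrix.PosSemidef.of_dotProduct_mulVec_nonneg ((hone _).sub hG) fun v => ?_
    have e1 := h2.dotProduct_mulVec_nonneg v
    have e3 := abs_le.mp (abs_dotProduct_mulVec_le (G - H) hη hGH v)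
    simp only [star_trivial, Matrix.sub_mulVec, Matrix.smul_mulVec, Matrix.one_mulVec,
      dotProduct_sub, dotProduct_smul, smul_eq_mul] at e1 e3 ⊢
    linarith

lemma Model.IsC2.continuous_gram {sys : Model n m S} (h : sys.IsC2) (i j : Fin S) :
    Continuous fun p : Vec n × Vec m =>
      (sys.regressor p.1 p.2 * (sys.regressor p.1 p.2)ᵀ) i j := by
  simp only [Matrix.mul_apply, Matrix.transpose_apply, Model.regressor, Matrix.of_apply]
  have hj := fun j => (h.2 j).continuous
  refine continuous_finsetSum _ fun l _ => Continuous.mul ?_ ?_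
  · exact (EuclideanSpace.proj l).continuous.comp (hj i)
  · exact (EuclideanSpace.proj l).continuous.comp (hj j)

/-- Persistent excitation is stable: it is inherited by every sequence that stays close enough to
a periodic persistently exciting one. -/
lemma Model.exists_isPEFrom_of_close (sys : Model n m S) (T : Tracking n m) (θ : Vec S)
    {M : ℕ} (hM : 0 < M) (hC2 : sys.IsC2) (hRef : sys.IsFeasiblePeriodic θ M T.xr T.ur)
    (hPE : sys.IsPEFrom M 0 T.xr T.ur) :
    ∃ δ : ℝ, 0 < δ ∧ ∀ (k₀ : ℕ) (x : ℕ → Vec n) (u : ℕ → Vec m),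
      (∀ k, k₀ ≤ k → ‖x k - T.xr k‖ < δ ∧ ‖u k - T.ur k‖ < δ) → sys.IsPEFrom M k₀ x u := by
  have hx : Function.Periodic T.xr M := hRef.state_periodic
  have hu : Function.Periodic T.ur M := hRef.input_periodic
  obtain ⟨α, β, hα, hβ, H⟩ := hPE
  -- The entrywise error of a window of `M` terms is then at most `α / (2 * (S + 1))`.
  set η : ℝ := α / (2 * (S + 1)) / M with hη
  have hM' : (0 : ℝ) < M := by exact_mod_cast hM
  have hηpos : 0 < η := by positivity
  set Φ : Vec n × Vec m → Matrix (Fin S) (Fin S) ℝ :=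
    fun p => sys.regressor p.1 p.2 * (sys.regressor p.1 p.2)ᵀ with hΦ
  have key : ∀ k : ℕ, ∃ δ : ℝ, 0 < δ ∧ ∀ p : Vec n × Vec m, dist p (T.xr k, T.ur k) < δ →
      ∀ i j, |(Φ p - Φ (T.xr k, T.ur k)) i j| ≤ η := by
    intro k
    have hev : ∀ᶠ p in nhds (T.xr k, T.ur k), ∀ i j,
        |(Φ p - Φ (T.xr k, T.ur k)) i j| ≤ η := by
      refine Filter.eventually_all.mpr fun i => Filter.eventually_all.mpr fun j => ?_
      have := Metric.tendsto_nhds.mp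
        ((hC2.continuous_gram i j).tendsto (T.xr k, T.ur k)) η hηpos
      filter_upwards [this] with p hp
      rw [Real.dist_eq] at hp
      exact hp.le
    exact Metric.eventually_nhds_iff.mp hev
  choose δ hδ hδΦ using key
  have hne : (Finset.range M).Nonempty := Finset.nonempty_range_iff.mpr hM.ne'
  refine ⟨(Finset.range M).inf' hne δ, (Finset.lt_inf'_iff _).mpr fun k _ => hδ k,
    fun k₀ x u hxu => ⟨α / 2, β + α / 2, by positivity, by positivity, fun j hj => ?_⟩⟩
  have hterm : ∀ k, k₀ ≤ k → ∀ i l, |(Φ (x k, u k) - Φ (T.xr k, T.ur k)) i l| ≤ η := by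
    intro k hk
    rw [← hx.map_mod_nat k, ← hu.map_mod_nat k]
    refine hδΦ (k % M) _ ?_
    rw [hx.map_mod_nat k, hu.map_mod_nat k, Prod.dist_eq, dist_eq_norm, dist_eq_norm]
    exact (max_lt (hxu k hk).1 (hxu k hk).2).trans_le
      (Finset.inf'_le _ (Finset.mem_range.mpr (Nat.mod_lt k hM)))
  have hherm : (∑ i ∈ Finset.Ico j (j + M), Φ (x i, u i)).IsHermitian := by
    simp [hΦ, Matrix.IsHermitian, Matrix.transpose_sum]
  have hclose : ∀ i l, |(∑ k ∈ Finset.Ico j (j + M), Φ (x k, u k) -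
      ∑ k ∈ Finset.Ico j (j + M), Φ (T.xr k, T.ur k)) i l| ≤ α / (2 * (S + 1)) := by
    intro i l
    rw [← Finset.sum_sub_distrib, Matrix.sum_apply]
    refine (Finset.abs_sum_le_sum_abs _ _).trans ((Finset.sum_le_card_nsmul _ _ η
      fun k hk => hterm k (hj.trans (Finset.mem_Ico.mp hk).1) i l).trans_eq ?_)
    rw [Nat.card_Ico, Nat.add_sub_cancel_left, nsmul_eq_mul, hη]
    field_simp
  have hS : α / (2 * (S + 1)) * S ≤ α / 2 := by
    rw [div_mul_eq_mul_div, div_le_div_iff₀ (by positivity) (by positivity)]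
    nlinarith
  obtain ⟨B1, B2⟩ := H j (Nat.zero_le _)
  obtain ⟨A1, A2⟩ := posSemidef_bounds_of_close hherm (by positivity) B1 B2 hclose
  have hI : ((α / 2 - α / (2 * (S + 1)) * S) • (1 : Matrix (Fin S) (Fin S) ℝ)).PosSemidef :=
    Matrix.PosSemidef.one.smul (by linarith)
  constructor
  · convert A1.add hI using 1
    module
  · convert A2.add hI using 1
    module

end AdaptiveMPC

/-! ### Excitation of the closed loop -/

open AdaptiveMPC in
theorem mainTheorem5 (n m S M : ℕ) (hM : 0 < M) (sys : Model n m S) (θ : Vec S)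
    (T : Tracking n m) (hQ : T.Q.PosDef) (hR : T.R.PosDef)
    (hC2 : sys.IsC2)
    (hHess : ∀ N : ℕ, 0 < N → sys.HessianPosDef T θ N)
    (hStab : LocallyIncrementallyStabilizable (sys.dyn θ))
    (hRef : sys.IsFeasiblePeriodic θ M T.xr T.ur)
    (hPE : sys.IsPEFrom M 0 T.xr T.ur) :
    ∃ cx : ℝ, 0 < cx ∧ ∃ N₀ : ℕ, 0 < N₀ ∧ ∀ N : ℕ, N₀ ≤ N →
      ∃ wbar cθ : ℝ, 0 < wbar ∧ 0 < cθ ∧ ∃ kPE : ℕ,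
        ∀ (θhat : ℕ → Vec S) (w x : ℕ → Vec n) (u : ℕ → Vec m),
          sys.IsClosedLoop T θ N wbar cθ θhat w x u → ‖x 0 - T.xr 0‖ ≤ cx →
            sys.IsPEFrom M kPE x u ∧
            ∀ kbar : ℕ, kPE ≤ kbar → kbar % M = 0 →
              ∀ (θhat' : ℕ → Vec S) (w' x' : ℕ → Vec n) (u' : ℕ → Vec m),
                sys.IsClosedLoop T θ N wbar cθ θhat' w' x' u' → x' 0 = x kbar →
                  sys.IsPEFrom M 0 x' u' := by
  obtain ⟨a, b, ha, hb, hstage⟩ := T.exists_stage_bounds hQ hR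
  have hlow := fun x u t => (hstage x u t).1
  obtain ⟨C, γ₁, hC, hγ₁⟩ := sys.exists_seqCost_le T θ hM hRef hStab hb
    fun x u t => (hstage x u t).2
  obtain ⟨γ, haγ, hγ⟩ : ∃ γ, a ≤ γ ∧ ∀ N k x, ‖x - T.xr k‖ ^ 2 ≤ C →
      ∃ u : ℕ → Vec m, sys.seqCost T θ N x u k ≤ γ * ‖x - T.xr k‖ ^ 2 :=
    ⟨max a γ₁, le_max_left _ _, fun N k x hx => (hγ₁ N k x hx).imp fun u hu =>
      hu.trans (mul_le_mul_of_nonneg_right (le_max_right _ _) (sq_nonneg _))⟩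
  have hγ0 : 0 < γ := ha.trans_le haγ
  obtain ⟨δ₀, hδ₀, hδPE⟩ := sys.exists_isPEFrom_of_close T θ hM hC2 hRef hPE
  set Y := a * C with hY
  have hYpos : 0 < Y := by positivity
  set μ := a / (2 * γ) with hμ
  have hμpos : 0 < μ := by positivity
  have hμ2 : μ ≤ 1 / 2 := by
    rw [hμ, div_le_div_iff₀ (by positivity) (by norm_num)]
    linarith
  have hμγ : γ * μ = a / 2 := by
    rw [hμ]
    field_simp
  -- Costs up to `δ` force excitation, and a state of cost at most `μ * δ` has, for any estimate
  -- within the bounds, an optimal cost of at most `δ`.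
  obtain ⟨δ, hδ, hδY, hδa⟩ : ∃ δ, 0 < δ ∧ δ ≤ Y ∧ δ < a * δ₀ ^ 2 :=
    ⟨min Y (a * δ₀ ^ 2 / 2), lt_min hYpos (by positivity), min_le_left _ _,
      (min_le_right _ _).trans_lt (half_lt_self (by positivity))⟩
  have hμδ : μ * δ ≤ δ / 2 := by nlinarith
  have hμδ0 : 0 < μ * δ := by positivity
  set ε := μ * (μ * δ) / 8 with hε
  have hεpos : 0 < ε := by positivity
  have hε16 : ε ≤ δ / 16 := by
    have := mul_le_mul_of_nonneg_right hμ2 hμδ0.le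
    linarith
  have hε4 : 4 * ε ≤ μ * δ := by nlinarith
  have hεY : 4 * ε ≤ μ * Y := hε4.trans (mul_le_mul_of_nonneg_left hδY hμpos.le)
  obtain ⟨L₀, hL₀⟩ := exists_nat_ge (2 * γ ^ 2 / a ^ 2)
  obtain ⟨kPE, hkPE⟩ := exists_pow_lt_of_lt_one (show 0 < μ * δ / 2 / Y by positivity)
    (show 1 - μ < 1 by linarith)
  have htrack : ∀ (k₀ : ℕ) (P : ℕ → ℝ) (x : ℕ → Vec n) (u : ℕ → Vec m),
      (∀ k, a * (‖x k - T.xr k‖ ^ 2 + ‖u k - T.ur k‖ ^ 2) ≤ P k) → (∀ k, k₀ ≤ k → P k ≤ δ) →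
      sys.IsPEFrom M k₀ x u := by
    refine fun k₀ P x u h1 h2 => hδPE k₀ x u fun k hk => ?_
    have h3 : ‖x k - T.xr k‖ ^ 2 + ‖u k - T.ur k‖ ^ 2 < δ₀ ^ 2 :=
      lt_of_mul_lt_mul_left (((h1 k).trans (h2 k hk)).trans_lt hδa) ha.le
    exact ⟨lt_of_pow_lt_pow_left₀ 2 hδ₀.le (by linarith [sq_nonneg ‖u k - T.ur k‖]),
      lt_of_pow_lt_pow_left₀ 2 hδ₀.le (by linarith [sq_nonneg ‖x k - T.xr k‖])⟩
  refine ⟨√(μ * C), by positivity, L₀ + 1, Nat.succ_pos _, fun N hN => ?_⟩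
  obtain ⟨L, rfl⟩ : ∃ L, N = L + 1 := ⟨N - 1, by omega⟩
  have hL : 2 * γ ^ 2 ≤ a ^ 2 * L := by
    rw [← div_le_iff₀' (by positivity)]
    exact hL₀.trans (by exact_mod_cast Nat.le_of_succ_le_succ hN)
  obtain ⟨d, hd, hclose⟩ := sys.exists_cost_close T θ hM hC2 hRef ha hlow (Nat.succ_pos L)
    (γ * C + 2 * (a * C)) hεpos
  refine ⟨d, d, hd, hd, kPE, fun θhat w x u hcl hx0 => ?_⟩
  obtain ⟨P, hP1, hP2, hP3⟩ := hcl.exists_lyapunov ha hC haγ hlow hγ hL hεpos.le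
    (by linarith) hd.le hclose
  have hx0' : ‖x 0 - T.xr 0‖ ^ 2 ≤ μ * C := by
    have := pow_le_pow_left₀ (norm_nonneg _) hx0 2
    rwa [Real.sq_sqrt (by positivity)] at this
  have hP0 : P 0 ≤ Y := by
    have h1 := hP2 0 (by nlinarith)
    have h2 : γ * ‖x 0 - T.xr 0‖ ^ 2 ≤ γ * (μ * C) := mul_le_mul_of_nonneg_left hx0' hγ0.le
    rw [← mul_assoc, hμγ] at h2
    linarith
  have hPk : ∀ k, kPE ≤ k → P k ≤ μ * δ := by
    intro k hk
    have h1 := le_pow_add_of_perturbed_contraction (by linarith) hεY hP0 hP3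
      (ζ := μ * δ / 2) (by positivity) (by linarith) k
    have h2 : (1 - μ) ^ k ≤ μ * δ / 2 / Y :=
      (pow_le_pow_of_le_one (by linarith) (by linarith) hk).trans hkPE.le
    rw [le_div_iff₀ hYpos] at h2
    linarith
  refine ⟨htrack kPE P x u hP1 fun k hk => (hPk k hk).trans (by linarith), ?_⟩
  intro kbar hk hkM θhat' w' x' u' hcl' hx'
  obtain ⟨P', hP1', hP2', hP3'⟩ := hcl'.exists_lyapunov ha hC haγ hlow hγ hL hεpos.le
    (by linarith) hd.le hclose
  have hxr : T.xr 0 = T.xr kbar := by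
    have hper : Function.Periodic T.xr M := hRef.state_periodic
    rw [← hper.map_mod_nat kbar, hkM]
  have hx'0 : a * ‖x' 0 - T.xr 0‖ ^ 2 ≤ μ * δ := by
    rw [hx', hxr]
    have := (hP1 kbar).trans (hPk kbar hk)
    nlinarith [sq_nonneg ‖u kbar - T.ur kbar‖]
  have hP0' : P' 0 ≤ δ := by
    have h1 := hP2' 0 (le_of_mul_le_mul_left (by linarith) ha)
    have h2 : γ * ‖x' 0 - T.xr 0‖ ^ 2 ≤ δ / 2 := by
      refine le_of_mul_le_mul_left ?_ ha
      calc a * (γ * ‖x' 0 - T.xr 0‖ ^ 2) = γ * (a * ‖x' 0 - T.xr 0‖ ^ 2) := by ring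
        _ ≤ γ * (μ * δ) := mul_le_mul_of_nonneg_left hx'0 hγ0.le
        _ = a * (δ / 2) := by rw [← mul_assoc, hμγ]; ring
    linarith
  exact htrack 0 P' x' u' hP1' fun k _ =>
    le_of_perturbed_contraction (by linarith) hε4 hP0' (fun k hk => hP3' k (hk.trans hδY)) k
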